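/- There are absolute constants $c>0$ and $\varepsilon_0>0$ such that for every integer $m\ge 2$ and every real $0<\varepsilon\le\varepsilon_0$, for all sufficiently large $n$ (as a function of $m$ and $\varepsilon$), the following holds. Let $\mathcal S_m$ be the set of probability distributions over $\{0,1\}^n$ supported by at most $m$ strings. Then every one-sided non-adaptive $\varepsilon$-test of $\mathcal S_m$ must make $\Omega(\varepsilon^{-1}m\log\varepsilon^{-1})$ queries: if it never makes more than $q$ queries, then \[ q\ \ge\ c\,\varepsilon^{-1}\, m\,\log_2 \varepsilon^{-1}. \] Here a non-adaptive algorithm with $s$ samples (for any $s$) draws, using its internal randomness only, a set $Q\subseteq\{1,\dots,s\}\times\{1,\dots,n\}$ of queries and a rule for accepting or rejecting based on the answers. It then receives the bits $(x_i)_j$ for $(i,j)\in Q$, where $x_1,\dots,x_s$ are independent samples of the unknown input distribution $P$ over $\{0,1\}^n$, and applies the rule; the number of queries is $|Q|$. It is a one-sided $\varepsilon$-test of $\mathcal S_m$ if it accepts every $P\in\mathcal S_m$ with probability $1$, and rejects with probability greater than $\frac23$ every $P$ for which $\min_{R\in\mathcal S_m}d_{\mathrm{EMD}}(P,R)>\varepsilon$.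 The earth mover's distance $d_{\mathrm{EMD}}(P,R)$ is the minimum, over all couplings $T$ of $P$ and $R$, of the expected normalized Hamming distance $\mathrm E_{(u,v)\sim T}\bigl[\frac1n|\{j:u_j\ne v_j\}|\bigr]$. -/

import Mathlib

namespace HugeObject

noncomputable section

/-- Binary strings of length `n`. -/
abbrev BitString (n : ℕ) : Type := Fin n → Bool

/-- Normalized Hamming distance: the fraction of coordinates in which two strings differ. -/
def stringDist {n : ℕ} (u v : BitString n) : ℝ := (hammingDist u v : ℝ) / (n : ℝ)

/-- `T` is a transfer distribution (coupling) from `P` to `Q`. -/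
def IsTransfer {n : ℕ} (T : PMF (BitString n × BitString n)) (P Q : PMF (BitString n)) : Prop :=
  T.map Prod.fst = P ∧ T.map Prod.snd = Q

/-- The expected string distance of a pair drawn from `T`. -/
def transferCost {n : ℕ} (T : PMF (BitString n × BitString n)) : ℝ :=
  ∑ p : BitString n × BitString n, (T p).toReal * stringDist p.1 p.2

/-- Earth mover's distance. The set is never empty (it contains the cost of the product
coupling) and is bounded below by `0`. -/
def emd {n : ℕ} (P Q : PMF (BitString n)) : ℝ :=
  sInf {e : ℝ | ∃ T : PMF (BitString n × BitString n), IsTransfer T P Q ∧ e = transferCost T}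

/-- Distance of a distribution from a (nonempty) property of distributions over `{0,1}^n`. -/
def distToProperty {n : ℕ} (P : PMF (BitString n)) (S : Set (PMF (BitString n))) : ℝ :=
  sInf ((fun Q : PMF (BitString n) => emd P Q) '' S)

/-- `S_m` over `{0,1}^n`: the distributions supported by at most `m` elements. -/
def boundedSupport (m n : ℕ) : Set (PMF (BitString n)) :=
  {P | P.support.ncard ≤ m}

/-- The matrix whose `s` rows are independent samples of `P`. -/
def samples {n : ℕ} (P : PMF (BitString n)) (s : ℕ) : PMF (Fin s → BitString n) :=
  PMF.ofFintype (fun x => ∏ i, P (x i)) (by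
    classical
    have h := Finset.prod_univ_sum (fun _ : Fin s => (Finset.univ : Finset (BitString n)))
      (fun _ v => P v)
    rw [Fintype.piFinset_univ] at h
    rw [← h]
    have h1 : ∑ v : BitString n, P v = 1 := by
      rw [← tsum_fintype (L := .unconditional _)]
      exact P.tsum_coe
    simp [h1])

/-- A deterministic non-adaptive algorithm with `s` samples: a set of queries `(i, j)` (the
`j`-th coordinate of the `i`-th sample) fixed in advance, and the verdict (`true` means
accept) as a function of the answers. -/
structure DetNonAdaptive (s n : ℕ) where
  queries : Finset (Fin s × Fin n)
  verdict : (queries → Bool) → Bool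

/-- The output of a deterministic non-adaptive algorithm on a matrix of samples. -/
def DetNonAdaptive.output {s n : ℕ} (D : DetNonAdaptive s n) (x : Fin s → BitString n) : Bool :=
  D.verdict (fun p => x p.1.1 p.1.2)

/-- A probabilistic non-adaptive algorithm: a distribution over deterministic ones. -/
abbrev NonAdaptive (s n : ℕ) : Type := PMF (DetNonAdaptive s n)

/-- The distribution of the output of `𝒜` (`true` means accept) on the input `P`. -/
def NonAdaptive.run {s n : ℕ} (𝒜 : NonAdaptive s n) (P : PMF (BitString n)) : PMF Bool :=
  PMF.bind 𝒜 (fun D => (samples P s).map D.output)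

/-- `𝒜` never makes more than `q` queries. -/
def NonAdaptive.QueriesAtMost {s n : ℕ} (𝒜 : NonAdaptive s n) (q : ℕ) : Prop :=
  ∀ D ∈ PMF.support 𝒜, D.queries.card ≤ q

/-- `𝒜` is an `ε`-test for `S`. -/
def NonAdaptive.IsTest {s n : ℕ} (𝒜 : NonAdaptive s n) (S : Set (PMF (BitString n)))
    (ε : ℝ) : Prop :=
  (∀ P ∈ S, 2 / 3 < 𝒜.run P true) ∧
  (∀ P : PMF (BitString n), ε < distToProperty P S → 2 / 3 < 𝒜.run P false)

/-- `𝒜` is a one-sided `ε`-test for `S`. -/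
def NonAdaptive.IsOneSidedTest {s n : ℕ} (𝒜 : NonAdaptive s n) (S : Set (PMF (BitString n)))
    (ε : ℝ) : Prop :=
  𝒜.IsTest S ε ∧ ∀ P ∈ S, 𝒜.run P true = 1

end

end HugeObject

/-! The hard inputs consist of t = ⌈m/3⌉ blocks. A block is a Hadamard codeword (the center) and
three perturbations of it, each flipping a different third of one "area", about a 1/M fraction of
the positions. Perturbations have total weight δ. These are 4t ≥ m + t strings at mutual distance of
order 1/M, so the distance to support size m is of order δ/M (`lt_distToProperty_blockString`).
Keeping δ/M of order ε leaves K ~ log(1/ε) scales δ = 2^-(k+1), M = 2^(K-k), with k < K.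

A one-sided test may reject only if no m strings explain the answers. A block can be explained by
two strings unless some column of the area is queried in two different perturbations of that block,
so rejection needs such a conflict in at least t/3 blocks (`le_three_mul_ncard_isOdd`). For a
uniformly random area, a column with r queries then contributes at most 3/M · min(1, (rδ/t)²) to the
rejection probability (`sum_reject_le`). Summed over scales this is a dyadic sum dominated by 2^k
near r/t, so one column cannot serve all scales, and the total is at most 9q/(t·2^K)
(`sum_scales_reject_le`). A test needs at least 2K/3 in total, whence q is at least of order
K·t·2^K. -/

namespace HugeObject

/-! ### Sample matrices and one-sidedness -/

/-- Sampling from a pushforward is the pushforward of sampling. -/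
theorem samples_map_map_apply_toReal {Λ : Type*} [Fintype Λ] {n : ℕ} (μ : PMF Λ)
    (f : Λ → BitString n) (s : ℕ) (g : (Fin s → BitString n) → Bool) (o : Bool) :
    (((samples (μ.map f) s).map g) o).toReal =
      ∑ l : Fin s → Λ, (∏ i, (μ (l i)).toReal) * (if g (f ∘ l) = o then 1 else 0) := by
  classical
  have h1 : ∀ x : Fin s → BitString n, samples (μ.map f) s x =
      ∑ l : Fin s → Λ, if f ∘ l = x then ∏ i, μ (l i) else 0 := by
    intro x
    have : samples (μ.map f) s x = ∏ i, (μ.map f) (x i) := rfl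
    rw [this]
    simp only [PMF.map_apply, tsum_fintype]
    rw [Finset.prod_univ_sum, Fintype.piFinset_univ]
    refine Finset.sum_congr rfl fun l _ => ?_
    by_cases h : f ∘ l = x
    · subst h; simp
    · rw [if_neg h]
      obtain ⟨i, hi⟩ := Function.ne_iff.1 h
      exact Finset.prod_eq_zero (Finset.mem_univ i) (if_neg fun h => hi h.symm)
  have h2 : ((samples (μ.map f) s).map g) o =
      ∑ l : Fin s → Λ, if g (f ∘ l) = o then ∏ i, μ (l i) else 0 := by
    rw [PMF.map_apply, tsum_fintype]
    simp_rw [h1]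
    have : ∀ x : Fin s → BitString n,
        (if o = g x then ∑ l : Fin s → Λ, (if f ∘ l = x then ∏ i, μ (l i) else 0) else 0) =
        ∑ l : Fin s → Λ, if f ∘ l = x then (if g (f ∘ l) = o then ∏ i, μ (l i) else 0) else 0 := by
      intro x
      split_ifs with h
      · refine Finset.sum_congr rfl fun l _ => ?_
        split_ifs with h3 h4 <;> simp_all
      · symm
        refine Finset.sum_eq_zero fun l _ => ?_
        split_ifs with h3 h4 <;> simp_all
    rw [Finset.sum_congr rfl fun x _ => this x, Finset.sum_comm]
    simp
  rw [h2, ENNReal.toReal_sum]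
  · refine Finset.sum_congr rfl fun l _ => ?_
    split_ifs <;> simp [ENNReal.toReal_prod]
  · intro l _
    split_ifs
    · exact ENNReal.prod_ne_top fun i _ => μ.apply_ne_top _
    · simp

/-- A one-sided test accepts every sample matrix whose rows come from at most `m` strings. -/
theorem NonAdaptive.IsOneSidedTest.output_eq_true {n s m : ℕ} {𝒜 : NonAdaptive s n} {ε : ℝ}
    (h : 𝒜.IsOneSidedTest (boundedSupport m n) ε) {D : DetNonAdaptive s n}
    (hD : D ∈ PMF.support 𝒜) {Λ : Type*} [Fintype Λ] [Nonempty Λ] (g : Λ → BitString n)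
    (hg : (Set.range g).ncard ≤ m) (l : Fin s → Λ) : D.output (g ∘ l) = true := by
  -- Any full-support law on `Λ` works: every `g ∘ l` then has positive probability, so a rule that
  -- never errs on `P` must accept it.
  set P := (PMF.uniformOfFintype Λ).map g with hP
  have hPm : P ∈ boundedSupport m n := by
    show P.support.ncard ≤ m
    rw [hP, PMF.support_map, PMF.support_uniformOfFintype]
    simpa using hg
  have h1 := (PMF.apply_eq_one_iff _ _).1 (h.2 P hPm)
  have h2 : D.output (g ∘ l) ∈ (𝒜.run P).support := by
    unfold NonAdaptive.run
    rw [PMF.mem_support_bind_iff]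
    refine ⟨D, hD, ?_⟩
    rw [PMF.mem_support_map_iff]
    refine ⟨g ∘ l, ?_, rfl⟩
    rw [PMF.mem_support_iff]
    show ∏ i, P (g (l i)) ≠ 0
    refine Finset.prod_ne_zero_iff.2 fun i _ => ?_
    rw [← PMF.mem_support_iff, hP, PMF.mem_support_map_iff]
    exact ⟨l i, by simp, rfl⟩
  rw [h1] at h2
  exact h2

/-! ### Distance from distributions of small support -/

theorem stringDist_comm {n : ℕ} (u v : BitString n) : stringDist u v = stringDist v u := by
  unfold stringDist; rw [hammingDist_comm]

theorem stringDist_nonneg {n : ℕ} (u v : BitString n) : 0 ≤ stringDist u v := by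
  unfold stringDist; positivity

theorem stringDist_triangle {n : ℕ} (u v w : BitString n) :
    stringDist u w ≤ stringDist u v + stringDist v w := by
  unfold stringDist
  rw [← add_div]
  gcongr
  exact_mod_cast hammingDist_triangle u v w

theorem exists_isTransfer {n : ℕ} (P Q : PMF (BitString n)) : ∃ T, IsTransfer T P Q := by
  refine ⟨P.bind fun u => Q.map (Prod.mk u), ?_, ?_⟩
  · rw [PMF.map_bind]
    simp only [PMF.map_comp]
    have : ∀ u : BitString n, (Prod.fst ∘ Prod.mk u : BitString n → BitString n)
      = Function.const _ u := fun u => rfl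
    simp [this, PMF.map_const]
  · rw [PMF.map_bind]
    simp only [PMF.map_comp]
    have : ∀ u : BitString n, (Prod.snd ∘ Prod.mk u : BitString n → BitString n) = id :=
      fun u => rfl
    simp [this, PMF.map_id]

/-- A distribution having many well separated atoms is far from all distributions with small
support. -/
theorem le_distToProperty_boundedSupport {Λ : Type*} [Fintype Λ] {n m t : ℕ} (hm : 1 ≤ m)
    (μ : PMF Λ) (f : Λ → BitString n) {η w : ℝ} (hw : 0 ≤ w) (hη : 0 ≤ η)
    (hμ : ∀ l, w ≤ (μ l).toReal)
    (hf : ∀ l l', l ≠ l' → η ≤ stringDist (f l) (f l')) (hcard : m + t ≤ Fintype.card Λ) :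
    t * w * (η / 2) ≤ distToProperty (μ.map f) (boundedSupport m n) := by
  classical
  unfold distToProperty
  refine le_csInf ?_ ?_
  · refine ⟨_, PMF.pure (fun _ => true), ?_, rfl⟩
    show (PMF.pure _).support.ncard ≤ m
    simpa using hm
  rintro _ ⟨R, hR, rfl⟩
  show _ ≤ emd (μ.map f) R
  unfold emd
  refine le_csInf ?_ ?_
  · obtain ⟨T, hT⟩ := exists_isTransfer (μ.map f) R
    exact ⟨_, T, hT, rfl⟩
  rintro _ ⟨T, ⟨hT1, hT2⟩, rfl⟩
  have hR' : R.support.ncard ≤ m := hR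
  set W : Finset Λ := Finset.univ.filter fun l => ∀ v ∈ R.support, η / 2 ≤ stringDist (f l) v
    with hWdef
  -- Two labels within `η / 2` of the same atom of `R` would be less than `η` apart, so the close
  -- labels inject into the support of `R`.
  have hWc : (Wᶜ).card ≤ m := by
    have hex : ∀ l ∈ Wᶜ, ∃ v ∈ R.support, stringDist (f l) v < η / 2 := by
      intro l hl
      simpa [hWdef, -PMF.mem_support_iff] using hl
    choose! φ hφ1 hφ2 using hex
    refine le_trans ?_ hR'
    rw [Set.ncard_eq_toFinset_card _ (Set.toFinite _)]
    refine Finset.card_le_card_of_injOn φ (fun l hl => by simpa using hφ1 l hl) ?_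
    intro l hl l' hl' hll
    by_contra hne
    have h1 := hf l l' hne
    have h2 := stringDist_triangle (f l) (φ l) (f l')
    have h3 := hφ2 l hl
    have h4 := hφ2 l' hl'
    rw [← hll, stringDist_comm] at h4
    linarith
  have hW : t ≤ W.card := by
    have := Finset.card_add_card_compl W
    omega
  -- All this mass has to travel at least `η / 2` under any coupling with `R`.
  have hmass : (t : ℝ) * w ≤ ∑ p : BitString n × BitString n,
      if p.1 ∈ W.image f then (T p).toReal else 0 := by
    have e1 : ∀ u, ((μ.map f) u).toReal = ∑ v, (T (u, v)).toReal := by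
      intro u
      rw [← hT1, PMF.map_apply, tsum_fintype, Fintype.sum_prod_type,
        Finset.sum_eq_single u]
      · simp only [if_true]
        exact ENNReal.toReal_sum fun v _ => T.apply_ne_top _
      · intro b _ hb
        simp [Ne.symm hb]
      · simp
    have e2 : ∀ u, ((μ.map f) u).toReal = ∑ l, if u = f l then (μ l).toReal else 0 := by
      intro u
      rw [PMF.map_apply, tsum_fintype, ENNReal.toReal_sum]
      · refine Finset.sum_congr rfl fun l _ => ?_
        split_ifs <;> simp
      · intro l _
        split_ifs
        · exact μ.apply_ne_top _
        · simp
    rw [Fintype.sum_prod_type]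
    calc (t : ℝ) * w ≤ W.card * w := by gcongr
      _ = ∑ l ∈ W, w := by simp
      _ ≤ ∑ l ∈ W, (μ l).toReal := Finset.sum_le_sum fun l _ => hμ l
      _ ≤ ∑ l, if f l ∈ W.image f then (μ l).toReal else 0 := by
          rw [← Finset.sum_filter]
          refine Finset.sum_le_sum_of_subset_of_nonneg ?_ fun _ _ _ => ENNReal.toReal_nonneg
          intro l hl
          simp only [Finset.mem_filter, Finset.mem_univ, true_and]
          exact Finset.mem_image_of_mem f hl
      _ = ∑ u, if u ∈ W.image f then ((μ.map f) u).toReal else 0 := by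
          have : ∀ u, (if u ∈ W.image f then ((μ.map f) u).toReal else 0) =
              ∑ l, if u = f l then (if f l ∈ W.image f then (μ l).toReal else 0) else 0 := by
            intro u
            rw [e2]
            split_ifs with h
            · refine Finset.sum_congr rfl fun l _ => ?_
              split_ifs with h1 h2
              · rfl
              · exact absurd (h1 ▸ h) h2
              · rfl
            · symm
              refine Finset.sum_eq_zero fun l _ => ?_
              split_ifs with h1 h2
              · exact absurd (h1 ▸ h2) h
              · rfl
              · rfl
          rw [Finset.sum_congr rfl fun u _ => this u, Finset.sum_comm]
          simp
      _ = _ := by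
          refine Finset.sum_congr rfl fun u _ => ?_
          split_ifs with h
          · rw [e1]
          · simp
  unfold transferCost
  calc (t : ℝ) * w * (η / 2) ≤ (∑ p : BitString n × BitString n,
      if p.1 ∈ W.image f then (T p).toReal else 0) * (η / 2) := by gcongr
    _ ≤ _ := by
      rw [Finset.sum_mul]
      refine Finset.sum_le_sum fun p _ => ?_
      split_ifs with h
      · by_cases h0 : T p = 0
        · simp [h0]
        · refine mul_le_mul_of_nonneg_left ?_ ENNReal.toReal_nonneg
          obtain ⟨l, hl, hlp⟩ := Finset.mem_image.1 h
          rw [← hlp]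
          refine (Finset.mem_filter.1 hl).2 _ ?_
          rw [← hT2, PMF.mem_support_map_iff]
          exact ⟨p, (PMF.mem_support_iff _ _).2 h0, rfl⟩
      · rw [zero_mul]
        exact mul_nonneg ENNReal.toReal_nonneg (stringDist_nonneg _ _)

/-! ### Pair collisions and the dyadic sum -/

/-- The probability that two independent samples with indices in `I` hit `S`. -/
theorem sum_prod_pair_le {Λ : Type*} [Fintype Λ] {s : ℕ} (w : Λ → ℝ)
    (hw : ∀ l, 0 ≤ w l) (hw1 : ∑ l, w l = 1) (S : Finset Λ) (I : Finset (Fin s))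
    (E : (Fin s → Λ) → Prop) [DecidablePred E]
    (hE : ∀ l, E l → ∃ i ∈ I, ∃ i' ∈ I, i ≠ i' ∧ l i ∈ S ∧ l i' ∈ S) :
    ∑ l : Fin s → Λ, (∏ i, w (l i)) * (if E l then 1 else 0) ≤
      min 1 ((I.card * ∑ l ∈ S, w l) ^ 2) := by
  classical
  have htot : ∑ l : Fin s → Λ, ∏ i, w (l i) = 1 := by
    have := Finset.prod_univ_sum (fun _ : Fin s => (Finset.univ : Finset Λ)) (fun _ v => w v)
    rw [Fintype.piFinset_univ] at this
    rw [← this]; simp [hw1]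
  have hpos : ∀ l : Fin s → Λ, 0 ≤ ∏ i, w (l i) := fun l => Finset.prod_nonneg fun i _ => hw _
  refine le_min ?_ ?_
  · refine le_of_le_of_eq (Finset.sum_le_sum fun l _ => ?_) htot
    split_ifs
    · simp
    · simpa using hpos l
  have hpair : ∀ i i' : Fin s, i ≠ i' → ∑ l : Fin s → Λ, (∏ i, w (l i)) *
      (if l i ∈ S ∧ l i' ∈ S then 1 else 0) = (∑ l ∈ S, w l) ^ 2 := by
    intro i i' hii
    have := Finset.prod_univ_sum (fun _ : Fin s => (Finset.univ : Finset Λ))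
      (fun k v => w v * if (k = i ∨ k = i') then (if v ∈ S then 1 else 0) else 1)
    rw [Fintype.piFinset_univ] at this
    have h2 : ∀ l : Fin s → Λ, (∏ i, w (l i)) * (if l i ∈ S ∧ l i' ∈ S then 1 else 0) =
        ∏ k, (w (l k) * if (k = i ∨ k = i') then (if l k ∈ S then 1 else 0) else 1) := by
      intro l
      rw [Finset.prod_mul_distrib]
      congr 1
      split_ifs with h
      · symm
        refine Finset.prod_eq_one fun k _ => ?_
        split_ifs with h1 h2
        · rfl
        · rcases h1 with rfl | rfl <;> tauto
        · rfl
      · symm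
        by_cases h1 : l i ∈ S
        · exact Finset.prod_eq_zero (Finset.mem_univ i') (by simp; tauto)
        · exact Finset.prod_eq_zero (Finset.mem_univ i) (by simp; tauto)
    rw [Finset.sum_congr rfl fun l _ => h2 l, ← this]
    have h3 : ∀ k : Fin s, ∑ v, (w v * if (k = i ∨ k = i') then (if v ∈ S then 1 else 0) else 1) =
        if k ∈ ({i, i'} : Finset (Fin s)) then ∑ l ∈ S, w l else 1 := by
      intro k
      by_cases hk : k = i ∨ k = i'
      · simp [hk]
      · simp [hk, hw1]
    rw [Finset.prod_congr rfl fun k _ => h3 k, Finset.prod_ite_mem, Finset.univ_inter,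
      Finset.prod_const, Finset.card_pair hii]
  -- Union bound over ordered pairs of distinct samples in `I`; independence gives each pair the
  -- squared mass of `S`.
  calc _ ≤ ∑ l : Fin s → Λ, ∑ q ∈ (I ×ˢ I).filter (fun q => q.1 ≠ q.2), (∏ i, w (l i)) *
        (if l q.1 ∈ S ∧ l q.2 ∈ S then 1 else 0) := by
        refine Finset.sum_le_sum fun l _ => ?_
        have hnn : ∀ q ∈ (I ×ˢ I).filter (fun q => q.1 ≠ q.2), 0 ≤ (∏ i, w (l i)) *
            (if l q.1 ∈ S ∧ l q.2 ∈ S then (1 : ℝ) else 0) := fun q _ =>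
          mul_nonneg (hpos l) (by split_ifs <;> norm_num)
        by_cases h : E l
        · obtain ⟨i, hi, i', hi', hii, h1, h2⟩ := hE l h
          refine le_trans ?_ (Finset.single_le_sum hnn
            (Finset.mem_filter.2 ⟨Finset.mk_mem_product hi hi', hii⟩))
          simp [h, h1, h2]
        · rw [if_neg h, mul_zero]
          exact Finset.sum_nonneg hnn
    _ = ∑ q ∈ (I ×ˢ I).filter (fun q => q.1 ≠ q.2), (∑ l ∈ S, w l) ^ 2 := by
        rw [Finset.sum_comm]
        exact Finset.sum_congr rfl fun q hq => hpair _ _ (Finset.mem_filter.1 hq).2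
    _ ≤ ∑ q ∈ I ×ˢ I, (∑ l ∈ S, w l) ^ 2 :=
        Finset.sum_le_sum_of_subset_of_nonneg (Finset.filter_subset _ _)
          fun _ _ _ => sq_nonneg _
    _ = _ := by
        rw [Finset.sum_const, Finset.card_product, nsmul_eq_mul]; push_cast; ring

/-- Dyadic summation of `min (2 ^ k) (x ^ 2 / 2 ^ k)`. -/
theorem sum_two_pow_mul_min_le {x : ℝ} (hx : 0 ≤ x) (K : ℕ) :
    ∑ k ∈ Finset.range K, (2 : ℝ) ^ k * min 1 ((x / 2 ^ k) ^ 2) ≤ 6 * x := by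
  rcases hx.eq_or_lt with rfl | hx
  · simp
  -- The bound is strengthened to a telescoping potential 6xy/(x + y) at y = 2^K; doubling y raises
  -- it by at least the next term, in both regimes y ≤ x and x ≤ y.
  have key : ∑ k ∈ Finset.range K, (2 : ℝ) ^ k * min 1 ((x / 2 ^ k) ^ 2) ≤
      6 * x * (2 ^ K / (x + 2 ^ K)) := by
    induction K with
    | zero => simp; positivity
    | succ K ih =>
      rw [Finset.sum_range_succ]
      have hy : (0 : ℝ) < 2 ^ K := by positivity
      rw [pow_succ (2 : ℝ) K]
      generalize (2 : ℝ) ^ K = y at *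
      refine (add_le_add_left ih _).trans ?_
      rw [← sub_nonneg]
      have e : 6 * x * (y * 2 / (x + y * 2)) - (6 * x * (y / (x + y)) + y * min 1 ((x / y) ^ 2)) =
        y * (6 * x ^ 2 / ((x + y * 2) * (x + y)) - min 1 ((x / y) ^ 2)) := by
        field_simp; ring
      rw [e]
      refine mul_nonneg hy.le (sub_nonneg.2 ?_)
      rw [le_div_iff₀ (by positivity)]
      rcases le_total y x with h | h
      · calc _ ≤ 1 * ((x + y * 2) * (x + y)) := by gcongr; exact min_le_left _ _
          _ ≤ _ := by nlinarith
      · calc _ ≤ (x / y) ^ 2 * ((x + y * 2) * (x + y)) := by gcongr; exact min_le_right _ _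
          _ ≤ (x / y) ^ 2 * (6 * y ^ 2) :=
            mul_le_mul_of_nonneg_left (by nlinarith) (by positivity)
          _ = _ := by field_simp
  refine key.trans ?_
  have : (2 : ℝ) ^ K / (x + 2 ^ K) ≤ 1 := by
    rw [div_le_one (by positivity)]; linarith
  nlinarith

/-! ### The hard strings and their realization in length `n` -/

/-- Positions of the strings `blockString`. -/
abbrev BlockPos (t M : ℕ) : Type := Fin M × Fin 3 × (Fin t → Bool)

/-- Labels of the strings `blockString`: a block together with either its center (`none`) or one
of its three perturbations. -/
abbrev BlockLabel (t : ℕ) : Type := Fin t × Option (Fin 3)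

/-- Block `b` is centered at the Hadamard codeword `p ↦ p.2.2 b`; its `e`-th perturbation flips
the positions whose first two components are `a` and `e`. -/
def blockString {t M : ℕ} (a : Fin M) (l : BlockLabel t) (p : BlockPos t M) : Bool :=
  xor (p.2.2 l.1) (decide (p.1 = a ∧ l.2 = some p.2.1))

/-- Within a block, some third of the area is flipped in exactly one of the two strings. Across
blocks, a second area (hence `2 ≤ M`) is unperturbed, and there the codewords differ on half of each
of its three cubes, which is 3·2^(t-1) positions. -/
theorem two_pow_le_hammingDist_blockString {t M : ℕ} (hM : 2 ≤ M) (a : Fin M)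
    {l l' : BlockLabel t} (h : l ≠ l') :
    2 ^ t ≤ hammingDist (blockString a l) (blockString a l') := by
  classical
  have hc : 2 ^ t = (Finset.univ : Finset (Fin t → Bool)).card := by simp
  rw [hc]
  unfold hammingDist
  obtain ⟨b, o⟩ := l
  obtain ⟨b', o'⟩ := l'
  by_cases hb : b = b'
  · subst hb
    have ho : o ≠ o' := fun ho => h (by rw [ho])
    obtain ⟨e, he⟩ : ∃ e : Fin 3, ¬(o = some e ↔ o' = some e) := by
      by_contra! hcon
      exact ho (Option.ext hcon)
    refine Finset.card_le_card_of_injOn (fun w => (a, e, w)) ?_ ?_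
    · intro w _
      have : decide (o = some e) ≠ decide (o' = some e) := by simpa using he
      simpa [blockString] using this
    · intro w _ w' _ hw
      simpa using hw
  · obtain ⟨a', ha'⟩ : ∃ a' : Fin M, a' ≠ a := by
      have : Nontrivial (Fin M) := Fin.nontrivial_iff_two_le.2 hM
      exact exists_ne a
    -- Vectors separating `b` from `b'` are kept in cube 0; the others are made separating by
    -- flipping coordinate `b` and go to cube 1.
    refine Finset.card_le_card_of_injOn
      (fun w => (a', if w b = w b' then 1 else 0,
        if w b = w b' then Function.update w b (!w b) else w)) ?_ ?_
    · intro w _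
      by_cases hw : w b = w b'
      · simp [blockString, ha', hw, Function.update_of_ne (Ne.symm hb)]
      · simp [blockString, ha', hw]
    · intro w _ w' _ hw
      simp only [Prod.mk.injEq, true_and] at hw
      obtain ⟨h1, h2⟩ := hw
      by_cases e1 : w b = w b' <;> by_cases e2 : w' b = w' b' <;> simp [e1, e2] at h1 h2
      · funext x
        have hx := congrFun h2 x
        by_cases hxb : x = b
        · subst hxb
          simp at hx
          rw [e1, e2, hx]
        · simpa [Function.update_of_ne hxb] using hx
      · exact h2

/-- A map to a finite type with fibers of comparable size. -/
theorem exists_balanced_map {A : Type*} [Fintype A] [DecidableEq A] {n : ℕ}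
    (hA : 0 < Fintype.card A) (hn : Fintype.card A ≤ n) :
    ∃ π : Fin n → A, ∀ a, n ≤ 2 * Fintype.card A * (Finset.univ.filter fun j => π j = a).card := by
  set d := Fintype.card A with hd
  let e := Fintype.equivFin A
  refine ⟨fun j => e.symm ⟨j % d, Nat.mod_lt _ hA⟩, fun a => ?_⟩
  -- Each residue class mod `d` has at least ⌊n/d⌋ members, and this is at least n/(2d) because `d ≤
  -- n`.
  have h1 : n / d ≤ (Finset.univ.filter fun j : Fin n =>
      e.symm ⟨j % d, Nat.mod_lt _ hA⟩ = a).card := by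
    have hlt : ∀ i : Fin (n / d), d * i + e a < n := by
      intro i
      have h2 : d * (i + 1) ≤ d * (n / d) := Nat.mul_le_mul_left _ i.2
      have h3 := Nat.mul_div_le n d
      have h4 := (e a).2
      rw [mul_add] at h2
      omega
    calc n / d = (Finset.univ : Finset (Fin (n / d))).card := by simp
      _ ≤ _ := by
        refine Finset.card_le_card_of_injOn (fun i => ⟨d * i + e a, hlt i⟩) ?_ ?_
        · intro i _
          simp only [Finset.coe_filter, Finset.mem_univ, true_and, Set.mem_ofPred_eq]
          rw [Equiv.symm_apply_eq]
          ext
          simp only [Nat.mul_add_mod]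
          exact Nat.mod_eq_of_lt (e a).2
        · intro i _ i' _ hi
          simp only [Fin.mk.injEq, Nat.add_right_cancel_iff] at hi
          exact Fin.ext (Nat.eq_of_mul_eq_mul_left hA hi)
  have h5 := Nat.div_add_mod n d
  have h6 := Nat.mod_lt n hA
  have h7 : 1 ≤ n / d := (Nat.one_le_div_iff hA).2 hn
  calc n ≤ d * (n / d) + d * 1 := by omega
    _ ≤ d * (n / d) + d * (n / d) := by gcongr
    _ = 2 * d * (n / d) := by ring
    _ ≤ _ := by gcongr

/-- Pulling back along a balanced map preserves normalized distances up to a factor of two. -/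
theorem le_stringDist_comp {A : Type*} [Fintype A] [DecidableEq A] {n : ℕ} (hn : 0 < n)
    (hA : 0 < Fintype.card A) {π : Fin n → A}
    (hπ : ∀ a, n ≤ 2 * Fintype.card A * (Finset.univ.filter fun j => π j = a).card)
    (u v : A → Bool) :
    (hammingDist u v : ℝ) / (2 * Fintype.card A) ≤ stringDist (u ∘ π) (v ∘ π) := by
  have h1 : hammingDist (u ∘ π) (v ∘ π) = ∑ a ∈ Finset.univ.filter (fun a => u a ≠ v a),
      (Finset.univ.filter fun j => π j = a).card := by
    unfold hammingDist
    rw [Finset.card_eq_sum_card_fiberwise (f := π) (t := Finset.univ.filter (fun a => u a ≠ v a))]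
    · refine Finset.sum_congr rfl fun a ha => ?_
      congr 1
      ext j
      simp only [Finset.mem_filter, Finset.mem_univ, true_and, Function.comp] at ha ⊢
      constructor
      · exact fun h => h.2
      · rintro rfl
        exact ⟨ha, rfl⟩
    · intro j hj
      simpa using hj
  have h2 : n * hammingDist u v ≤ 2 * Fintype.card A * hammingDist (u ∘ π) (v ∘ π) := by
    rw [h1, Finset.mul_sum]
    unfold hammingDist
    rw [mul_comm, ← smul_eq_mul, ← Finset.sum_const]
    exact Finset.sum_le_sum fun a _ => hπ a
  unfold stringDist
  have hn' : (0 : ℝ) < n := by exact_mod_cast hn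
  have hA' : (0 : ℝ) < Fintype.card A := by exact_mod_cast hA
  rw [div_le_div_iff₀ (by positivity) hn']
  have : (n : ℝ) * hammingDist u v ≤ 2 * Fintype.card A * hammingDist (u ∘ π) (v ∘ π) := by
    exact_mod_cast h2
  linarith

theorem exists_pmf_toReal_eq {Λ : Type*} [Fintype Λ] (w : Λ → ℝ) (hw : ∀ l, 0 ≤ w l)
    (hw1 : ∑ l, w l = 1) : ∃ μ : PMF Λ, ∀ l, (μ l).toReal = w l := by
  refine ⟨PMF.ofFintype (fun l => ENNReal.ofReal (w l)) ?_, fun l => ?_⟩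
  · rw [← ENNReal.ofReal_sum_of_nonneg fun l _ => hw l, hw1, ENNReal.ofReal_one]
  · rw [PMF.ofFintype_apply, ENNReal.toReal_ofReal (hw l)]

/-! ### Weights of centers and perturbations -/

/-- The weight of a label when perturbations have total weight `δ`. -/
noncomputable def blockWeight (t : ℕ) (δ : ℝ) (l : BlockLabel t) : ℝ :=
  if l.2 = none then (1 - δ) / t else δ / (3 * t)

theorem sum_blockWeight {t : ℕ} (ht : 0 < t) (δ : ℝ) : ∑ l, blockWeight t δ l = 1 := by
  have : (t : ℝ) ≠ 0 := by positivity
  rw [Fintype.sum_prod_type]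
  simp [blockWeight, Fintype.sum_option]
  field_simp
  ring

/-- Perturbations are the lightest atoms; this is the uniform lower bound on atoms that the distance
estimate needs. -/
theorem le_blockWeight {t : ℕ} {δ : ℝ} (hδ : δ ≤ 1 / 2) (l : BlockLabel t) :
    δ / (3 * t) ≤ blockWeight t δ l := by
  unfold blockWeight
  split_ifs
  · rw [← div_div]
    gcongr
    linarith
  · exact le_rfl

/-- The perturbed labels of block `b`. -/
def blockNoise {t : ℕ} (b : Fin t) : Finset (BlockLabel t) :=
  (Finset.univ : Finset (Fin 3)).map ⟨fun e => (b, some e), fun e e' h => by simpa using h⟩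

theorem sum_blockNoise {t : ℕ} (b : Fin t) (δ : ℝ) :
    ∑ l ∈ blockNoise b, blockWeight t δ l = δ / t := by
  simp [blockNoise, blockWeight]
  ring

/-! ### Conflicts and rejection -/

section Conflict

variable {t M n s : ℕ} (π : Fin n → BlockPos t M) (Q : Finset (Fin s × Fin n))

/-- Some query column inside the perturbed area `a` sees two different perturbations of `b`. -/
def IsOdd (a : Fin M) (l : Fin s → BlockLabel t) (b : Fin t) : Prop :=
  ∃ j, (π j).1 = a ∧ ∃ i, (i, j) ∈ Q ∧ ∃ i', (i', j) ∈ Q ∧ ∃ e e' : Fin 3, e ≠ e' ∧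
    l i = (b, some e) ∧ l i' = (b, some e')

/-- If few blocks see a conflict, the queried bits are consistent with few strings. -/
theorem exists_consistent_of_isOdd (a : Fin M) (l : Fin s → BlockLabel t) :
    ∃ g : BlockLabel t → BitString n,
      (Set.range g).ncard ≤ 2 * t + 2 * {b | IsOdd π Q a l b}.ncard ∧
      ∀ i j, (i, j) ∈ Q → g (l i) j = blockString a (l i) (π j) := by
  classical
  -- One string replaces all three perturbations of `b`: it flips a column exactly when a queried
  -- sample there shows the flip.
  let y : Fin t → BitString n := fun b j =>
    xor ((π j).2.2 b) (decide ((π j).1 = a ∧ ∃ i, (i, j) ∈ Q ∧ l i = (b, some (π j).2.1)))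
  let g : BlockLabel t → BitString n := fun k =>
    if IsOdd π Q a l k.1 then blockString a k ∘ π
    else if k.2 = none then blockString a k ∘ π else y k.1
  refine ⟨g, ?_, ?_⟩
  · have hsub : Set.range g ⊆ ↑(Finset.univ.biUnion fun b : Fin t =>
        (Finset.univ : Finset (Option (Fin 3))).image fun o => g (b, o)) := by
      rintro _ ⟨⟨b, o⟩, rfl⟩
      simp
    refine (Set.ncard_le_ncard hsub (Finset.finite_toSet _)).trans ?_
    rw [Set.ncard_coe_finset]
    refine Finset.card_biUnion_le.trans ?_
    have hb : ∀ b : Fin t, ((Finset.univ : Finset (Option (Fin 3))).image fun o => g (b, o)).card ≤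
        2 + 2 * if IsOdd π Q a l b then 1 else 0 := by
      intro b
      by_cases h : IsOdd π Q a l b
      · refine Finset.card_image_le.trans ?_
        simp [h]
      · rw [if_neg h]
        have : ((Finset.univ : Finset (Option (Fin 3))).image fun o => g (b, o)) ⊆
            {g (b, none), y b} := by
          intro v hv
          obtain ⟨o, -, rfl⟩ := Finset.mem_image.1 hv
          cases o with
          | none => simp
          | some e => simp [g, h]
        exact (Finset.card_le_card this).trans Finset.card_le_two
    refine (Finset.sum_le_sum fun b _ => hb b).trans ?_
    rw [Finset.sum_add_distrib, ← Finset.mul_sum, Set.ncard_eq_toFinset_card']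
    simp [mul_comm]
  · intro i j hij
    by_cases h : IsOdd π Q a l (l i).1
    · simp [g, h]
    · by_cases h2 : (l i).2 = none
      · simp [g, h2]
      · obtain ⟨e, he⟩ := Option.ne_none_iff_exists'.1 h2
        have hl : l i = (((l i).1, some e) : BlockLabel t) := Prod.ext rfl he
        have hg : g (l i) = y (l i).1 := by simp only [g, if_neg h, if_neg h2]
        rw [hg]
        simp only [y, blockString]
        congr 1
        rw [decide_eq_decide]
        -- If `y` flips column `j` because of another sample while sample `i` does not, then two
        -- different perturbations are queried in column `j`, which is a conflict.
        refine and_congr_right fun ha => ⟨?_, fun h3 => ⟨i, hij, Prod.ext rfl h3⟩⟩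
        rintro ⟨i', hi', hl'⟩
        by_contra hne
        refine h ⟨j, ha, i, hij, i', hi', e, (π j).2.1, ?_, hl, hl'⟩
        rintro rfl
        exact hne he

end Conflict

/-- A rejected outcome of a one-sided test sees a conflict in many blocks. -/
theorem le_three_mul_ncard_isOdd {t M n s m : ℕ} {𝒜 : NonAdaptive s n} {ε : ℝ} (hm : 2 ≤ m)
    (ht : t = (m + 2) / 3) (h : 𝒜.IsOneSidedTest (boundedSupport m n) ε) {D : DetNonAdaptive s n}
    (hD : D ∈ PMF.support 𝒜) (π : Fin n → BlockPos t M) (a : Fin M) (l : Fin s → BlockLabel t)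
    (hl : D.output ((fun k => blockString a k ∘ π) ∘ l) = false) :
    t ≤ 3 * {b | IsOdd π D.queries a l b}.ncard := by
  obtain ⟨g, hg, hgl⟩ := exists_consistent_of_isOdd π D.queries a l
  have h1 : D.output (g ∘ l) = false := by
    rw [← hl]
    unfold DetNonAdaptive.output
    congr 1
    funext p
    exact hgl _ _ p.2
  have h2 : ¬ (Set.range g).ncard ≤ m := by
    intro h3
    have : Nonempty (BlockLabel t) := ⟨(⟨0, by omega⟩, none)⟩
    rw [h.output_eq_true hD g h3 l] at h1
    exact Bool.noConfusion h1
  -- From 2t + 2·#conflicts > m and m ≥ 3t - 2. The hypothesis `2 ≤ m` gives 2t ≤ m, which excludes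
  -- zero conflicts.
  omega

/-! ### Rejection probability at one scale and over all scales -/

/-- Averaged over the perturbed area, the rejection probability is bounded column by column. -/
theorem sum_reject_le {t M n s m : ℕ} {𝒜 : NonAdaptive s n} {ε δ : ℝ} (hm : 2 ≤ m)
    (ht : t = (m + 2) / 3) (h : 𝒜.IsOneSidedTest (boundedSupport m n) ε) {D : DetNonAdaptive s n}
    (hD : D ∈ PMF.support 𝒜) (π : Fin n → BlockPos t M) (hδ0 : 0 ≤ δ) (hδ : δ ≤ 1 / 2) :
    ∑ a : Fin M, ∑ l : Fin s → BlockLabel t, (∏ i, blockWeight t δ (l i)) *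
      (if D.output ((fun k => blockString a k ∘ π) ∘ l) = false then 1 else 0) ≤
    3 * ∑ j : Fin n, min 1
      (((Finset.univ.filter fun i => (i, j) ∈ D.queries).card * (δ / t)) ^ 2) := by
  classical
  have ht0 : 0 < t := by omega
  have ht0' : (0 : ℝ) < t := by exact_mod_cast ht0
  have hw : ∀ l, 0 ≤ blockWeight t δ l := fun l => le_trans (by positivity) (le_blockWeight hδ l)
  have hpos : ∀ l : Fin s → BlockLabel t, 0 ≤ ∏ i, blockWeight t δ (l i) :=
    fun l => Finset.prod_nonneg fun i _ => hw _
  let E : Fin t → Fin n → (Fin s → BlockLabel t) → Prop := fun b j l =>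
    ∃ i ∈ Finset.univ.filter (fun i => (i, j) ∈ D.queries),
      ∃ i' ∈ Finset.univ.filter (fun i => (i, j) ∈ D.queries),
      i ≠ i' ∧ l i ∈ blockNoise b ∧ l i' ∈ blockNoise b
  -- Markov's inequality in pointwise form: rejection is charged to pairs (block, column). `E`
  -- forgets which perturbations were seen and keeps only that two queried samples are perturbations
  -- of `b`.
  have h1 : ∀ (a : Fin M) (l : Fin s → BlockLabel t),
      (t : ℝ) * (if D.output ((fun k => blockString a k ∘ π) ∘ l) = false then 1 else 0) ≤
      3 * ∑ b, ∑ j, if (π j).1 = a then (if E b j l then 1 else 0) else 0 := by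
    intro a l
    have hnn : ∀ (b : Fin t) (j : Fin n), (0 : ℝ) ≤
        if (π j).1 = a then (if E b j l then 1 else 0) else 0 := by
      intro b j; split_ifs <;> norm_num
    split_ifs with hout
    · have h2 := le_three_mul_ncard_isOdd hm ht h hD π a l hout
      have h3 : ({b | IsOdd π D.queries a l b}.ncard : ℝ) =
          ∑ b, if IsOdd π D.queries a l b then 1 else 0 := by
        rw [Set.ncard_eq_toFinset_card']
        simp
      have h4 : (t : ℝ) ≤ 3 * ({b | IsOdd π D.queries a l b}.ncard : ℝ) := by exact_mod_cast h2
      rw [mul_one]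
      refine h4.trans ?_
      rw [h3]
      gcongr with b
      split_ifs with hb
      · obtain ⟨j, hj, i, hi, i', hi', e, e', hee, he, he'⟩ := hb
        refine le_trans ?_ (Finset.single_le_sum (fun j _ => hnn b j) (Finset.mem_univ j))
        have : E b j l := by
          refine ⟨i, by simpa using hi, i', by simpa using hi', ?_, ?_, ?_⟩
          · rintro rfl
            rw [he] at he'
            exact hee (by simpa using he')
          · exact he ▸ Finset.mem_map.2 ⟨e, Finset.mem_univ _, rfl⟩
          · exact he' ▸ Finset.mem_map.2 ⟨e', Finset.mem_univ _, rfl⟩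
        simp [hj, this]
      · exact Finset.sum_nonneg fun j _ => hnn b j
    · rw [mul_zero]
      exact mul_nonneg (by norm_num) (Finset.sum_nonneg fun b _ => Finset.sum_nonneg
        fun j _ => hnn b j)
  refine le_of_mul_le_mul_left ?_ ht0'
  calc _ = ∑ a : Fin M, ∑ l : Fin s → BlockLabel t, (∏ i, blockWeight t δ (l i)) *
      ((t : ℝ) * (if D.output ((fun k => blockString a k ∘ π) ∘ l) = false then 1 else 0)) := by
        simp_rw [Finset.mul_sum]
        refine Finset.sum_congr rfl fun a _ => Finset.sum_congr rfl fun l _ => ?_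
        ring
    _ ≤ ∑ a : Fin M, ∑ l : Fin s → BlockLabel t, (∏ i, blockWeight t δ (l i)) *
      (3 * ∑ b, ∑ j, if (π j).1 = a then (if E b j l then 1 else 0) else 0) :=
        Finset.sum_le_sum fun a _ => Finset.sum_le_sum fun l _ =>
          mul_le_mul_of_nonneg_left (h1 a l) (hpos l)
    _ = 3 * ∑ l : Fin s → BlockLabel t, (∏ i, blockWeight t δ (l i)) *
      (∑ a : Fin M, ∑ b, ∑ j, if (π j).1 = a then (if E b j l then 1 else 0) else 0) := by
        rw [Finset.sum_comm, Finset.mul_sum]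
        refine Finset.sum_congr rfl fun l _ => ?_
        simp_rw [Finset.mul_sum]
        refine Finset.sum_congr rfl fun a _ => Finset.sum_congr rfl fun b _ =>
          Finset.sum_congr rfl fun j _ => ?_
        ring
    -- Each column lies in exactly one area, so summing over `a` counts it once; this is the gain
    -- from hiding the area.
    _ = 3 * ∑ l : Fin s → BlockLabel t, (∏ i, blockWeight t δ (l i)) *
      (∑ b, ∑ j, if E b j l then 1 else 0) := by
        congr 1
        refine Finset.sum_congr rfl fun l _ => ?_
        congr 1
        rw [Finset.sum_comm]
        refine Finset.sum_congr rfl fun b _ => ?_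
        rw [Finset.sum_comm]
        simp
    _ = 3 * ∑ b, ∑ j, ∑ l : Fin s → BlockLabel t, (∏ i, blockWeight t δ (l i)) *
      (if E b j l then 1 else 0) := by
        congr 1
        simp_rw [Finset.mul_sum]
        rw [Finset.sum_comm]
        refine Finset.sum_congr rfl fun b _ => ?_
        rw [Finset.sum_comm]
    _ ≤ 3 * ∑ b : Fin t, ∑ j : Fin n, min 1
      (((Finset.univ.filter fun i => (i, j) ∈ D.queries).card * (δ / t)) ^ 2) := by
        gcongr with b _ j _
        have := sum_prod_pair_le (blockWeight t δ) hw (sum_blockWeight ht0 δ) (blockNoise b)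
          (Finset.univ.filter fun i => (i, j) ∈ D.queries) (E b j) (fun l hl => hl)
        rwa [sum_blockNoise] at this
    _ = _ := by
        rw [Finset.sum_const]
        simp
        ring

/-- Summing the rejection probabilities over all scales. -/
theorem sum_scales_reject_le {t n s m K q : ℕ} {𝒜 : NonAdaptive s n} {ε : ℝ} (hm : 2 ≤ m)
    (ht : t = (m + 2) / 3) (h : 𝒜.IsOneSidedTest (boundedSupport m n) ε) (hq : 𝒜.QueriesAtMost q)
    {D : DetNonAdaptive s n} (hD : D ∈ PMF.support 𝒜)
    (π : ∀ k, Fin n → BlockPos t (2 ^ (K - k))) :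
    ∑ k ∈ Finset.range K, ∑ a : Fin (2 ^ (K - k)), ((2 : ℝ) ^ (K - k))⁻¹ *
      ∑ l : Fin s → BlockLabel t, (∏ i, blockWeight t ((2 : ℝ) ^ (k + 1))⁻¹ (l i)) *
      (if D.output ((fun x => blockString a x ∘ π k) ∘ l) = false then 1 else 0) ≤
    9 * q / (t * 2 ^ K) := by
  classical
  have ht0 : 0 < t := by omega
  have ht0' : (0 : ℝ) < t := by exact_mod_cast ht0
  let r : Fin n → ℝ := fun j => (Finset.univ.filter fun i => (i, j) ∈ D.queries).card
  have hr : ∑ j, r j = D.queries.card := by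
    have := Finset.card_eq_sum_card_fiberwise (s := D.queries) (f := Prod.snd)
      (t := Finset.univ) (by simp)
    rw [this]
    push_cast
    refine Finset.sum_congr rfl fun j _ => ?_
    simp only [r]
    norm_cast
    refine Finset.card_bij (fun i _ => (i, j)) ?_ ?_ ?_
    · intro i hi
      simpa using hi
    · intro i _ i' _ hi
      simpa using hi
    · rintro ⟨i, j'⟩ hi
      simp only [Finset.mem_filter] at hi
      obtain ⟨hi, rfl⟩ := hi
      exact ⟨i, by simpa using hi, rfl⟩
  calc _ ≤ ∑ k ∈ Finset.range K, ((2 : ℝ) ^ (K - k))⁻¹ *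
        (3 * ∑ j : Fin n, min 1 ((r j * (((2 : ℝ) ^ (k + 1))⁻¹ / t)) ^ 2)) := by
        refine Finset.sum_le_sum fun k _ => ?_
        rw [← Finset.mul_sum]
        refine mul_le_mul_of_nonneg_left ?_ (by positivity)
        refine sum_reject_le hm ht h hD (π k) (by positivity) ?_
        rw [one_div]
        gcongr
        rw [pow_succ]
        have : (1 : ℝ) ≤ 2 ^ k := one_le_pow₀ (by norm_num)
        linarith
    -- The area weight 2^-(K-k) equals 2^k/2^K, giving the dyadic sum with x = r_j/(2t).
    _ = ∑ j : Fin n, 3 / 2 ^ K * ∑ k ∈ Finset.range K,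
        (2 : ℝ) ^ k * min 1 ((r j / (2 * t) / 2 ^ k) ^ 2) := by
        simp_rw [Finset.mul_sum]
        rw [Finset.sum_comm]
        refine Finset.sum_congr rfl fun j _ => Finset.sum_congr rfl fun k hk => ?_
        have hk' : k ≤ K := (Finset.mem_range.1 hk).le
        have e1 : r j * (((2 : ℝ) ^ (k + 1))⁻¹ / t) = r j / (2 * t) / 2 ^ k := by
          field_simp
          ring
        have e2 : (2 : ℝ) ^ K = 2 ^ (K - k) * 2 ^ k := by
          rw [← pow_add, Nat.sub_add_cancel hk']
        rw [e1, e2]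
        field_simp
    _ ≤ ∑ j : Fin n, 3 / 2 ^ K * (6 * (r j / (2 * t))) := by
        gcongr with j
        exact sum_two_pow_mul_min_le (by simp only [r]; positivity) K
    _ = 9 * D.queries.card / (t * 2 ^ K) := by
        rw [← hr, Finset.mul_sum, Finset.sum_div]
        refine Finset.sum_congr rfl fun j _ => ?_
        field_simp
        ring
    _ ≤ _ := by
        have := hq D hD
        gcongr

/-- If every deterministic outcome of `𝒜` has small weighted rejection probability, so has `𝒜`. -/
theorem sum_mul_le_of_forall_support {ι : Type*} (I : Finset ι) {n s : ℕ} (𝒜 : NonAdaptive s n)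
    (P : ι → PMF (BitString n)) (c : ι → ℝ) (hc : ∀ i, 0 ≤ c i) {B : ℝ} (hB : 0 ≤ B)
    (hP : ∀ i ∈ I, 2 / 3 < 𝒜.run (P i) false)
    (hD : ∀ D ∈ PMF.support 𝒜,
      ∑ i ∈ I, c i * (((samples (P i) s).map D.output) false).toReal ≤ B) :
    ∑ i ∈ I, c i * (2 / 3) ≤ B := by
  -- In `ENNReal` the average over 𝒜 can be exchanged with the finite sum without summability
  -- conditions.
  rw [← ENNReal.ofReal_le_ofReal_iff hB]
  calc ENNReal.ofReal (∑ i ∈ I, c i * (2 / 3))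
      = ∑ i ∈ I, ENNReal.ofReal (c i) * (2 / 3) := by
        rw [ENNReal.ofReal_sum_of_nonneg fun i _ => mul_nonneg (hc i) (by norm_num)]
        refine Finset.sum_congr rfl fun i _ => ?_
        rw [ENNReal.ofReal_mul (hc i), ENNReal.ofReal_div_of_pos (by norm_num)]
        norm_num
    _ ≤ ∑ i ∈ I, ENNReal.ofReal (c i) * 𝒜.run (P i) false :=
        Finset.sum_le_sum fun i hi => by gcongr; exact (hP i hi).le
    _ = ∑' D, 𝒜 D * ∑ i ∈ I, ENNReal.ofReal (c i) * ((samples (P i) s).map D.output) false := by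
        have : ∀ D, 𝒜 D * ∑ i ∈ I, ENNReal.ofReal (c i) * ((samples (P i) s).map D.output) false =
            ∑ i ∈ I, ENNReal.ofReal (c i) * (𝒜 D * ((samples (P i) s).map D.output) false) := by
          intro D
          rw [Finset.mul_sum]
          exact Finset.sum_congr rfl fun i _ => by ring
        simp_rw [this]
        rw [Summable.tsum_finsetSum fun i _ => ENNReal.summable]
        refine Finset.sum_congr rfl fun i _ => ?_
        rw [ENNReal.tsum_mul_left, NonAdaptive.run, PMF.bind_apply]
    _ ≤ ∑' D, 𝒜 D * ENNReal.ofReal B := by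
        refine ENNReal.tsum_le_tsum fun D => ?_
        by_cases h0 : 𝒜 D = 0
        · simp [h0]
        · gcongr
          refine le_of_eq_of_le ?_
            (ENNReal.ofReal_le_ofReal (hD D ((PMF.mem_support_iff _ _).2 h0)))
          rw [ENNReal.ofReal_sum_of_nonneg fun i _ => mul_nonneg (hc i) ENNReal.toReal_nonneg]
          refine Finset.sum_congr rfl fun i _ => ?_
          rw [ENNReal.ofReal_mul (hc i), ENNReal.ofReal_toReal (PMF.apply_ne_top _ _)]
    _ = ENNReal.ofReal B := by rw [ENNReal.tsum_mul_right, 𝒜.tsum_coe, one_mul]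

/-! ### Assembling the lower bound -/

/-- The hard distributions are far from having support of size `m`. -/
theorem lt_distToProperty_blockString {t n m K k : ℕ} {ε : ℝ} (hm : 2 ≤ m)
    (ht : t = (m + 2) / 3) (hk : k < K) (hε : 72 * ε * 2 ^ K < 1) (hn : 0 < n)
    {π : Fin n → BlockPos t (2 ^ (K - k))}
    (hπ : ∀ p, n ≤ 2 * Fintype.card (BlockPos t (2 ^ (K - k))) *
      (Finset.univ.filter fun j => π j = p).card)
    (a : Fin (2 ^ (K - k))) (μ : PMF (BlockLabel t))
    (hμ : ∀ l, (μ l).toReal = blockWeight t ((2 : ℝ) ^ (k + 1))⁻¹ l) :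
    ε < distToProperty (μ.map fun x => blockString a x ∘ π) (boundedSupport m n) := by
  have ht0 : 0 < t := by omega
  have ht0' : (0 : ℝ) < t := by exact_mod_cast ht0
  have hcard : Fintype.card (BlockPos t (2 ^ (K - k))) = 2 ^ (K - k) * (3 * 2 ^ t) := by
    simp
  have hM : 2 ≤ 2 ^ (K - k) := by
    calc 2 = 2 ^ 1 := rfl
      _ ≤ 2 ^ (K - k) := Nat.pow_le_pow_right (by norm_num) (by omega)
  have hδ : ((2 : ℝ) ^ (k + 1))⁻¹ ≤ 1 / 2 := by
    rw [one_div]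
    gcongr
    rw [pow_succ]
    have : (1 : ℝ) ≤ 2 ^ k := one_le_pow₀ (by norm_num)
    linarith
  -- The separation is 2^t out of 3M·2^t positions, halved by the balanced map: 1/(6M). The product
  -- t · δ/(3t) · 1/(12M) is 1/(72·2^K) at every scale.
  have hfar := le_distToProperty_boundedSupport (t := t) (m := m) (by omega) μ
    (fun x => blockString a x ∘ π) (η := (6 * 2 ^ (K - k))⁻¹)
    (w := ((2 : ℝ) ^ (k + 1))⁻¹ / (3 * t)) (by positivity) (by positivity)
    (fun l => by rw [hμ]; exact le_blockWeight hδ l) ?_ (by simp; omega)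
  · refine lt_of_lt_of_le ?_ hfar
    have e2 : (2 : ℝ) ^ K = 2 ^ (K - k) * 2 ^ k := by
      rw [← pow_add, Nat.sub_add_cancel hk.le]
    have e3 : (t : ℝ) * (((2 : ℝ) ^ (k + 1))⁻¹ / (3 * t)) * ((6 * 2 ^ (K - k))⁻¹ / 2) =
        1 / (72 * 2 ^ K) := by
      rw [e2, pow_succ]
      field_simp
      norm_num
    rw [e3, lt_div_iff₀ (by positivity)]
    linarith
  · intro l l' hl
    refine le_trans ?_ (le_stringDist_comp hn (by rw [hcard]; positivity) hπ _ _)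
    have h1 : (2 : ℝ) ^ t ≤ hammingDist (blockString a l) (blockString a l') := by
      exact_mod_cast two_pow_le_hammingDist_blockString hM a hl
    rw [hcard]
    calc (6 * (2 : ℝ) ^ (K - k))⁻¹ = 2 ^ t / (2 * ((2 ^ (K - k) * (3 * 2 ^ t) : ℕ) : ℝ)) := by
          push_cast
          field_simp
          norm_num
      _ ≤ _ := by gcongr

/-- The lower bound in terms of the number `K` of scales. -/
theorem mul_le_queries {n s m K q : ℕ} {𝒜 : NonAdaptive s n} {ε : ℝ} (hm : 2 ≤ m)
    (hε : 72 * ε * 2 ^ K < 1) (hn : 2 ^ K * (3 * 2 ^ ((m + 2) / 3)) ≤ n)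
    (hq : 𝒜.QueriesAtMost q) (h : 𝒜.IsOneSidedTest (boundedSupport m n) ε) :
    2 * (K * m * 2 ^ K : ℝ) ≤ 81 * q := by
  classical
  obtain ⟨t, ht⟩ : ∃ t, t = (m + 2) / 3 := ⟨_, rfl⟩
  rw [← ht] at hn
  have ht0 : 0 < t := by omega
  have ht0' : (0 : ℝ) < t := by exact_mod_cast ht0
  have hn0 : 0 < n := lt_of_lt_of_le (by positivity) hn
  have hπ : ∀ k, ∃ π : Fin n → BlockPos t (2 ^ (K - k)),
      ∀ p, n ≤ 2 * Fintype.card (BlockPos t (2 ^ (K - k))) *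
        (Finset.univ.filter fun j => π j = p).card := by
    intro k
    have hcard : Fintype.card (BlockPos t (2 ^ (K - k))) = 2 ^ (K - k) * (3 * 2 ^ t) := by
      simp
    refine exists_balanced_map (by rw [hcard]; positivity) ?_
    rw [hcard]
    refine le_trans ?_ hn
    gcongr
    · norm_num
    · omega
  choose π hπ using hπ
  have hμ : ∀ k : ℕ, ∃ μ : PMF (BlockLabel t),
      ∀ l, (μ l).toReal = blockWeight t ((2 : ℝ) ^ (k + 1))⁻¹ l := by
    intro k
    refine exists_pmf_toReal_eq _ (fun l => le_trans ?_ (le_blockWeight ?_ l))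
      (sum_blockWeight ht0 _)
    · positivity
    · rw [one_div]
      gcongr
      rw [pow_succ]
      have : (1 : ℝ) ≤ 2 ^ k := one_le_pow₀ (by norm_num)
      linarith
  choose μ hμ using hμ
  -- Each scale gets total weight 1, spread evenly over its areas, so the left side becomes 2K/3.
  have key := sum_mul_le_of_forall_support
    ((Finset.range K).sigma fun k => (Finset.univ : Finset (Fin (2 ^ (K - k))))) 𝒜
    (fun i => (μ i.1).map fun x => blockString i.2 x ∘ π i.1)
    (fun i => ((2 : ℝ) ^ (K - i.1))⁻¹) (fun i => by positivity)
    (B := 9 * q / (t * 2 ^ K)) (by positivity) ?_ ?_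
  · rw [Finset.sum_sigma] at key
    simp only [Finset.sum_const, Finset.card_univ, Fintype.card_fin, nsmul_eq_mul, Nat.cast_pow,
      Nat.cast_ofNat] at key
    have e : ∀ k ∈ Finset.range K, (2 : ℝ) ^ (K - k) * (((2 : ℝ) ^ (K - k))⁻¹ * (2 / 3)) = 2 / 3 :=
      fun k _ => by field_simp
    rw [Finset.sum_congr rfl e, Finset.sum_const, Finset.card_range, nsmul_eq_mul,
      le_div_iff₀ (by positivity)] at key
    have hmt : (m : ℝ) ≤ 3 * t := by
      have : m ≤ 3 * t := by omega
      exact_mod_cast this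
    have : (K : ℝ) * m * 2 ^ K ≤ K * (3 * t) * 2 ^ K := by gcongr
    linarith
  · rintro ⟨k, a⟩ hi
    have hk : k < K := by simpa using hi
    exact h.1.2 _ (lt_distToProperty_blockString hm ht hk hε hn0 (hπ k) a (μ k) (hμ k))
  · intro D hD
    rw [Finset.sum_sigma]
    simp only [samples_map_map_apply_toReal, hμ]
    exact sum_scales_reject_le hm ht h hq hD π

end HugeObject

theorem mainTheorem6 :
    ∃ c : ℝ, 0 < c ∧ ∃ ε₀ : ℝ, 0 < ε₀ ∧
      ∀ m : ℕ, 2 ≤ m → ∀ ε : ℝ, 0 < ε → ε ≤ ε₀ →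
        ∃ N : ℕ, ∀ n : ℕ, N ≤ n →
          ∀ (s q : ℕ) (𝒜 : HugeObject.NonAdaptive s n),
            HugeObject.NonAdaptive.QueriesAtMost 𝒜 q →
            HugeObject.NonAdaptive.IsOneSidedTest 𝒜 (HugeObject.boundedSupport m n) ε →
              c * (ε⁻¹ * (m : ℝ) * Real.logb 2 ε⁻¹) ≤ (q : ℝ) := by
  -- 20736 = 81 · 256, where 81 comes from `mul_le_queries` and 256 from ε⁻¹ ≤ 256·2^K. With ε ≤
  -- 2^-16 the logarithm is at least 16, so K ≥ 8 and K + 8 ≤ 2K.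
  refine ⟨1 / 20736, by norm_num, 1 / 2 ^ 16, by norm_num, fun m hm ε hε hε₀ => ?_⟩
  have hinv : (2 : ℝ) ^ 16 ≤ ε⁻¹ := by
    rw [le_inv_comm₀ (by norm_num) hε, ← one_div]
    exact hε₀
  -- 128 is a power of two above 72: it makes 72·ε·2^K < 1 strict and the logarithm exact.
  obtain ⟨K, hK1, hK2⟩ := exists_nat_pow_near (x := ε⁻¹ / 128) (y := 2)
    (by rw [le_div_iff₀ (by norm_num)]; linarith) (by norm_num)
  -- The number of block positions at the finest partition into areas, k = 0.
  refine ⟨2 ^ K * (3 * 2 ^ ((m + 2) / 3)), fun n hn s q 𝒜 hq h => ?_⟩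
  have hKε : 128 * ε * 2 ^ K ≤ 1 := by
    rw [le_div_iff₀ (by norm_num)] at hK1
    calc 128 * ε * 2 ^ K = ε * (2 ^ K * 128) := by ring
      _ ≤ ε * ε⁻¹ := by gcongr
      _ = 1 := mul_inv_cancel₀ hε.ne'
  have hpos : 0 < ε * 2 ^ K := by positivity
  have key := HugeObject.mul_le_queries hm (by linarith) hn hq h
  have hpow : ε⁻¹ ≤ 256 * 2 ^ K := by
    rw [pow_succ] at hK2
    linarith
  have hlog : Real.logb 2 ε⁻¹ ≤ K + 8 := by
    rw [Real.logb_le_iff_le_rpow (by norm_num) (by positivity)]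
    refine hpow.trans (le_of_eq ?_)
    rw [Real.rpow_add (by norm_num), Real.rpow_natCast]
    norm_num
    ring
  have hlog16 : 16 ≤ Real.logb 2 ε⁻¹ := by
    rw [Real.le_logb_iff_rpow_le (by norm_num) (by positivity)]
    refine le_trans (le_of_eq ?_) hinv
    norm_num
  have hfin : ε⁻¹ * m * Real.logb 2 ε⁻¹ ≤ 256 * 2 ^ K * m * (2 * K) := by
    gcongr
    linarith
  linarith
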